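/- Equip $\mathbb{R}^m$, $\mathbb{R}^n$ and $\mathbb{R}^m\times\mathbb{R}^n$ with the Euclidean inner product and norm. For a set $\Omega$ in a Euclidean space and $z\in\Omega$, let $$T_\Omega(z):=\{w\mid \exists\, t_k\downarrow 0,\ w_k\to w:\ z+t_kw_k\in\Omega\ \forall k\}$$ be the tangent (Bouligand) cone, let $$\widehat N_\Omega(z):=T_\Omega(z)^\circ=\{z^*\mid \langle z^*,w\rangle\le 0\ \forall w\in T_\Omega(z)\}$$ be the regular normal cone (with $\widehat N_\Omega(z):=\varnothing$ for $z\notin\Omega$), and for a direction $w$ let $$N_\Omega(z;w):=\{z^*\mid\exists\, t_k\downarrow0,\ w_k\to w,\ z_k^*\to z^*:\ z_k^*\in\widehat N_\Omega(z+t_kw_k)\ \forall k\}$$ be the directional limiting normal cone. For a set-valued mapping $M\colon\mathbb{R}^m\rightrightarrows\mathbb{R}^n$ with graph $\operatorname{gph}M:=\{(y,x)\mid x\in M(y)\}$ and $(\bar y,\bar x)\in\operatorname{gph}M$, put $$DM(\bar y,\bar x)(v):=\{u\mid (v,u)\in T_{\operatorname{gph}M}(\bar y,\bar x)\},$$ $$D^*M((\bar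 y,\bar x);(v,u))(x^*):=\{y^*\mid (y^*,-x^*)\in N_{\operatorname{gph}M}((\bar y,\bar x);(v,u))\}.$$ The mapping $M$ is called calm at $(\bar y,\bar x)$ if there is some $\kappa>0$ such that for all sequences $(x_k)\subset\mathbb{R}^n$ and $(y_k)\subset\mathbb{R}^m$ with $x_k\to\bar x$ and $x_k\in M(y_k)$ for all $k$, there is a sequence $(\tilde x_k)\subset M(\bar y)$ with $\|x_k-\tilde x_k\|\le\kappa\|y_k-\bar y\|$ for all sufficiently large $k$. **Lemma.** Let $M\colon\mathbb{R}^m\rightrightarrows\mathbb{R}^n$ be a set-valued mapping, let $(\bar y,\bar x)\in\operatorname{gph}M$, and suppose that $\operatorname{gph}M$ is locally closed around $(\bar y,\bar x)$ (that is, $\operatorname{gph}M\cap U$ is closed for some closed neighborhood $U$ of $(\bar y,\bar x)$). If $$D^*M((\bar y,\bar x);(0,u))(0)=\{0\}\qquad\text{for all } u\in DM(\bar y,\bar x)(0)\setminus\{0\},$$ then $M$ is calm at $(\bar y,\bar x)$. -/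

import Mathlib

open Filter Topology

namespace VarAnalysis

section Cones

variable {E : Type*} [NormedAddCommGroup E] [InnerProductSpace ℝ E]

/-- `Ω` is locally closed around `z`: its intersection with some closed neighborhood of `z`
is closed. -/
def LocallyClosedAround (Ω : Set E) (z : E) : Prop :=
  ∃ U ∈ 𝓝 z, IsClosed U ∧ IsClosed (Ω ∩ U)

/-- The polar cone `Ω° = {z* | ⟨z*, z⟩ ≤ 0 for all z ∈ Ω}`. -/
def polarCone (Ω : Set E) : Set E :=
  {zs | ∀ z ∈ Ω, inner ℝ zs z ≤ 0}

/-- The tangent (Bouligand, contingent) cone `T_Ω(z)`; it is empty for `z ∉ Ω`. -/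
def bouligandCone (Ω : Set E) (z : E) : Set E :=
  {w | z ∈ Ω ∧ ∃ (t : ℕ → ℝ) (ws : ℕ → E),
    (∀ k, 0 < t k) ∧ Tendsto t atTop (𝓝 0) ∧ Tendsto ws atTop (𝓝 w) ∧
    ∀ k, z + t k • ws k ∈ Ω}

/-- The regular (Fréchet) normal cone: the polar of the tangent cone if `z ∈ Ω`, and empty
for `z ∉ Ω`. -/
def regularNormalCone (Ω : Set E) (z : E) : Set E :=
  {zs | z ∈ Ω ∧ zs ∈ polarCone (bouligandCone Ω z)}

/-- The directional limiting normal cone `N_Ω(z; w)`; it is empty for `z ∉ Ω`. -/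
def directionalLimitingNormalCone (Ω : Set E) (z w : E) : Set E :=
  {zs | z ∈ Ω ∧ ∃ (t : ℕ → ℝ) (ws : ℕ → E) (zsk : ℕ → E),
    (∀ k, 0 < t k) ∧ Tendsto t atTop (𝓝 0) ∧ Tendsto ws atTop (𝓝 w) ∧
    Tendsto zsk atTop (𝓝 zs) ∧ ∀ k, zsk k ∈ regularNormalCone Ω (z + t k • ws k)}

end Cones

section SetValued

variable {m n : ℕ}

/-- The graph of a set-valued mapping `M : ℝᵐ ⇉ ℝⁿ`, as a subset of the Euclidean product space
`ℝᵐ × ℝⁿ` (hence the `L²` product). -/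
def gph (M : EuclideanSpace ℝ (Fin m) → Set (EuclideanSpace ℝ (Fin n))) :
    Set (WithLp 2 (EuclideanSpace ℝ (Fin m) × EuclideanSpace ℝ (Fin n))) :=
  {p | p.snd ∈ M p.fst}

/-- The graphical derivative `DM(y, x)(v)`. -/
def graphicalDerivative (M : EuclideanSpace ℝ (Fin m) → Set (EuclideanSpace ℝ (Fin n)))
    (y : EuclideanSpace ℝ (Fin m)) (x : EuclideanSpace ℝ (Fin n))
    (v : EuclideanSpace ℝ (Fin m)) : Set (EuclideanSpace ℝ (Fin n)) :=
  {u | WithLp.toLp 2 (v, u) ∈ bouligandCone (gph M) (WithLp.toLp 2 (y, x))}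

/-- The directional limiting coderivative `D*M((y, x); (v, u))(x*)`. -/
def directionalLimitingCoderivative
    (M : EuclideanSpace ℝ (Fin m) → Set (EuclideanSpace ℝ (Fin n)))
    (y : EuclideanSpace ℝ (Fin m)) (x : EuclideanSpace ℝ (Fin n))
    (v : EuclideanSpace ℝ (Fin m)) (u : EuclideanSpace ℝ (Fin n))
    (xs : EuclideanSpace ℝ (Fin n)) : Set (EuclideanSpace ℝ (Fin m)) :=
  {ys | WithLp.toLp 2 (ys, -xs) ∈
    directionalLimitingNormalCone (gph M) (WithLp.toLp 2 (y, x)) (WithLp.toLp 2 (v, u))}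

/-- The first-order sufficient condition for calmness:
`D*M((y, x); (0, u))(0) = {0}` for all `u ∈ DM(y, x)(0) \ {0}`. -/
def FOSCclm (M : EuclideanSpace ℝ (Fin m) → Set (EuclideanSpace ℝ (Fin n)))
    (y : EuclideanSpace ℝ (Fin m)) (x : EuclideanSpace ℝ (Fin n)) : Prop :=
  ∀ u ∈ graphicalDerivative M y x 0 \ {0},
    directionalLimitingCoderivative M y x 0 u 0 = {0}

/-- `M` is calm at a point `(y, x)` of its graph, in the sequential formulation. The points `ys k`
are not required to converge to `y`. -/
def IsCalmAt (M : EuclideanSpace ℝ (Fin m) → Set (EuclideanSpace ℝ (Fin n)))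
    (y : EuclideanSpace ℝ (Fin m)) (x : EuclideanSpace ℝ (Fin n)) : Prop :=
  ∃ κ : ℝ, 0 < κ ∧
    ∀ (xs : ℕ → EuclideanSpace ℝ (Fin n)) (ys : ℕ → EuclideanSpace ℝ (Fin m)),
      Tendsto xs atTop (𝓝 x) → (∀ k, xs k ∈ M (ys k)) →
        ∃ xt : ℕ → EuclideanSpace ℝ (Fin n), (∀ k, xt k ∈ M y) ∧
          ∀ᶠ k in atTop, ‖xs k - xt k‖ ≤ κ * ‖ys k - y‖

end SetValued

end VarAnalysis

namespace VarAnalysis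

open scoped NNReal

section Cones

variable {E F : Type*} [NormedAddCommGroup E] [InnerProductSpace ℝ E]
  [NormedAddCommGroup F] [InnerProductSpace ℝ F]

/-! If calmness fails, then for each large `k` some graph point `p = (y, x)` near `(ybar, xbar)` has
`x` farther than `k² ‖y - ybar‖` from every point of `M ybar`. Minimizing `‖v.fst - ybar‖ + a ‖v.snd
- x‖²` over the graph near `(ybar, xbar)` gives a point `z` that stays too close to `x` to have
`z.fst = ybar`. The penalty is thus differentiable at `z`, and minus its gradient is a regular
normal with unit first component and second component `O(1/k)` (`exists_regularNormal_of_penalty`).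
Moreover `z` approaches the base point along directions whose first component vanishes in the limit.
Compactness (`exists_directionalLimitingNormal`) then yields a tangent direction `(0, u)`, `u ≠ 0`,
and a limiting normal `(y*, 0)` with `‖y*‖ = 1`, contrary to the coderivative condition. -/

theorem bouligandCone_subset_posTangentConeAt (Ω : Set E) (z : E) :
    bouligandCone Ω z ⊆ posTangentConeAt Ω z := by
  rintro w ⟨-, t, ws, ht, ht0, hws, hmem⟩
  refine mem_tangentConeAt_of_seq atTop (fun k => (t k)⁻¹.toNNReal)
    (fun k => t k • ws k) ?_ (.of_forall hmem) ?_
  · simpa using ht0.smul hws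
  · refine hws.congr fun k => ?_
    rw [NNReal.smul_def, Real.coe_toNNReal _ (inv_pos.2 (ht k)).le, inv_smul_smul₀ (ht k).ne']

/-- First-order optimality: minus the gradient at a local minimizer over `Ω` is a regular normal. -/
theorem neg_mem_regularNormalCone_of_isLocalMinOn {Ω : Set E} {z g : E} {φ : E → ℝ}
    (hz : z ∈ Ω) (hmin : IsLocalMinOn φ Ω z) (hφ : HasFDerivAt φ (innerSL ℝ g) z) :
    -g ∈ regularNormalCone Ω z := by
  refine ⟨hz, fun w hw => ?_⟩
  have := hmin.hasFDerivWithinAt_nonneg hφ.hasFDerivWithinAt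
    (bouligandCone_subset_posTangentConeAt Ω z hw)
  simpa [inner_neg_left] using this

theorem hasFDerivAt_norm_sub {y c : E} (h : y ≠ c) :
    HasFDerivAt (fun v : E => ‖v - c‖) (innerSL ℝ (‖y - c‖⁻¹ • (y - c))) y := by
  have h0 : ‖y - c‖ ≠ 0 := norm_ne_zero_iff.2 (sub_ne_zero.2 h)
  have h1 := (((hasFDerivAt_id (𝕜 := ℝ) y).sub_const c).norm_sq).sqrt (by simpa using h0)
  simp only [id, Real.sqrt_sq (norm_nonneg _)] at h1
  refine h1.congr_fderiv ?_
  ext w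
  simp
  field_simp

/-- The gradient of the penalty function `z ↦ ‖z₁ - c‖ + a ‖z₂ - b‖²`. -/
theorem hasFDerivAt_norm_add_norm_sq {z : WithLp 2 (E × F)} {c : E} {b : F} (a : ℝ)
    (h : z.fst ≠ c) :
    HasFDerivAt (fun v : WithLp 2 (E × F) => ‖v.fst - c‖ + a * ‖v.snd - b‖ ^ 2)
      (innerSL ℝ (WithLp.toLp 2 (‖z.fst - c‖⁻¹ • (z.fst - c), (2 * a) • (z.snd - b)))) z := by
  have h1 := (hasFDerivAt_norm_sub h).comp z (WithLp.fstL 2 ℝ E F).hasFDerivAt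
  have h2 := ((((WithLp.sndL 2 ℝ E F).hasFDerivAt (x := z)).sub_const b).norm_sq).const_mul a
  refine (h1.add h2).congr_fderiv ?_
  ext w
  simp [inner_sub_left, real_inner_smul_left, WithLp.prod_inner_apply]
  ring

/-- Bounds at a minimizer `z` of the penalty function, at which `z.fst = c` is excluded. -/
theorem exists_regularNormal_of_penalty [ProperSpace (WithLp 2 (E × F))]
    {Ω : Set (WithLp 2 (E × F))} {zb p : WithLp 2 (E × F)} {r k : ℝ} (hk : 2 ≤ k)
    (hcl : IsClosed (Ω ∩ Metric.closedBall zb r)) (hzb : zb ∈ Ω) (hp : p ∈ Ω)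
    (hpr : 3 * ‖p.snd - zb.snd‖ < r)
    (hbad : ∀ x, WithLp.toLp 2 (zb.fst, x) ∈ Ω → k ^ 2 * ‖p.fst - zb.fst‖ < ‖p.snd - x‖) :
    ∃ z ∈ Metric.ball zb r, z ≠ zb ∧ k * ‖z.fst - zb.fst‖ ≤ ‖z.snd - zb.snd‖ ∧
      ∃ q ∈ regularNormalCone Ω z, ‖q.fst‖ = 1 ∧ k * ‖q.snd‖ ≤ 2 := by
  set ε := ‖p.fst - zb.fst‖ with hε
  set d := ‖p.snd - zb.snd‖ with hd
  have hεd : k ^ 2 * ε < d := hbad zb.snd hzb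
  have hεpos : 0 < ε := by
    refine (norm_nonneg _).lt_of_ne' fun h0 => ?_
    have h1 : p.fst = zb.fst := sub_eq_zero.1 (norm_eq_zero.1 h0)
    have := hbad p.snd (by rw [← h1]; exact hp)
    rw [sub_self, norm_zero] at this
    exact absurd this (not_lt.2 (by positivity))
  have hnorm : ∀ v : WithLp 2 (E × F), ‖v‖ ≤ ‖v.fst‖ + ‖v.snd‖ := fun v => by
    refine abs_le_of_sq_le_sq' ?_ (by positivity) |>.2
    rw [WithLp.prod_norm_sq_eq_of_L2]
    nlinarith [norm_nonneg v.fst, norm_nonneg v.snd]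
  -- Here `2 ≤ k` enters: moving `x` by `k * ε` uses up at most half of the gap `k ^ 2 * ε`.
  have hke : k * ε ≤ k ^ 2 * ε - k * ε := by nlinarith [mul_pos hεpos (by linarith : 0 < k)]
  have hεk : ε ≤ k * ε := by nlinarith
  -- This weight balances two demands: the value `ε` at `p` confines `z.snd` to within `k * ε` of
  -- `p.snd`, and the penalty gradient there is at most `2 * a * (k * ε) = 2 / k`.
  set a : ℝ := (k ^ 2 * ε)⁻¹ with ha
  have hk0 : 0 < k := by linarith
  have hapos : 0 < a := by positivity
  let φ : WithLp 2 (E × F) → ℝ := fun v => ‖v.fst - zb.fst‖ + a * ‖v.snd - p.snd‖ ^ 2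
  have hpK : p ∈ Ω ∩ Metric.closedBall zb r := by
    refine ⟨hp, ?_⟩
    rw [mem_closedBall_iff_norm]
    refine (hnorm _).trans ?_
    simp only [WithLp.sub_fst, WithLp.sub_snd]
    linarith
  have hK : IsCompact (Ω ∩ Metric.closedBall zb r) := by
    rw [← Set.inter_eq_left.2 (Set.inter_subset_right (s := Ω)), Set.inter_comm]
    exact (isCompact_closedBall zb r).inter_right hcl
  obtain ⟨z, hzK, hzmin⟩ := hK.exists_isMinOn ⟨p, hpK⟩ (f := φ) (by
    have h1 : Continuous fun v : WithLp 2 (E × F) => v.fst := (WithLp.fstL 2 ℝ E F).continuous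
    have h2 : Continuous fun v : WithLp 2 (E × F) => v.snd := (WithLp.sndL 2 ℝ E F).continuous
    fun_prop)
  have hφz : ‖z.fst - zb.fst‖ + a * ‖z.snd - p.snd‖ ^ 2 ≤ ε := by
    simpa [φ] using hzmin hpK
  have hzy : ‖z.fst - zb.fst‖ ≤ ε := by nlinarith [sq_nonneg ‖z.snd - p.snd‖]
  have hzx : ‖z.snd - p.snd‖ ≤ k * ε := by
    refine abs_le_of_sq_le_sq' ?_ (by positivity) |>.2
    have h1 : a * ‖z.snd - p.snd‖ ^ 2 ≤ ε := by linarith [norm_nonneg (z.fst - zb.fst)]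
    rw [ha, inv_mul_le_iff₀ (by positivity)] at h1
    linarith
  have hzd : d - k * ε ≤ ‖z.snd - zb.snd‖ := by
    have := norm_sub_le_norm_sub_add_norm_sub p.snd z.snd zb.snd
    rw [norm_sub_rev p.snd z.snd] at this
    linarith
  -- Otherwise `z.snd` would be an admissible `x` in `hbad` at distance at most `k * ε < k ^ 2 * ε`
  -- from `p.snd`.
  have hne : z.fst ≠ zb.fst := fun h => by
    have := hbad z.snd (by rw [← h]; exact hzK.1)
    rw [norm_sub_rev] at this
    nlinarith [mul_pos hεpos hk0]
  -- The distance is at most `ε + k * ε + d < 2 * d < r`; being interior makes `z` a local minimizer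
  -- over all of `Ω`.
  have hzr : z ∈ Metric.ball zb r := by
    rw [mem_ball_iff_norm]
    refine (hnorm _).trans_lt ?_
    have := norm_sub_le_norm_sub_add_norm_sub z.snd p.snd zb.snd
    simp only [WithLp.sub_fst, WithLp.sub_snd]
    linarith
  have hloc : IsLocalMinOn φ Ω z := by
    filter_upwards [self_mem_nhdsWithin,
      mem_nhdsWithin_of_mem_nhds (Metric.isOpen_ball.mem_nhds hzr)] with v hv hvr
    exact hzmin ⟨hv, Metric.ball_subset_closedBall hvr⟩
  refine ⟨z, hzr, fun h => hne (by rw [h]), ?_, _, neg_mem_regularNormalCone_of_isLocalMinOn hzK.1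
    hloc (hasFDerivAt_norm_add_norm_sq a hne), ?_, ?_⟩
  · nlinarith
  · have : ‖z.fst - zb.fst‖ ≠ 0 := norm_ne_zero_iff.2 (sub_ne_zero.2 hne)
    simp [norm_smul, this]
  · rw [WithLp.neg_snd, norm_neg, WithLp.toLp_snd, norm_smul, Real.norm_of_nonneg (by positivity)]
    calc k * (2 * a * ‖z.snd - p.snd‖) ≤ k * (2 * a * (k * ε)) := by gcongr
      _ = 2 := by rw [ha]; field_simp

/-- Compactness: approximate normals along a sequence approaching `zb` yield a directional limiting
normal in a tangent direction. -/
theorem exists_directionalLimitingNormal [ProperSpace E] {Ω : Set E} {zb : E} (hzb : zb ∈ Ω)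
    {z q : ℕ → E} (hz : Tendsto z atTop (𝓝 zb)) (hne : ∀ k, z k ≠ zb)
    (hq : ∀ k, q k ∈ regularNormalCone Ω (z k)) {R : ℝ} (hR : ∀ k, ‖q k‖ ≤ R) :
    ∃ w ζ : E, ∃ ψ : ℕ → ℕ, StrictMono ψ ∧ w ∈ bouligandCone Ω zb ∧
      ζ ∈ directionalLimitingNormalCone Ω zb w ∧ ‖w‖ = 1 ∧
      Tendsto (fun k => ‖z (ψ k) - zb‖⁻¹ • (z (ψ k) - zb)) atTop (𝓝 w) ∧
      Tendsto (q ∘ ψ) atTop (𝓝 ζ) := by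
  have hpos : ∀ k, 0 < ‖z k - zb‖ := fun k => norm_pos_iff.2 (sub_ne_zero.2 (hne k))
  have hunit : ∀ k, ‖‖z k - zb‖⁻¹ • (z k - zb)‖ = 1 := fun k => by
    rw [norm_smul, norm_inv, norm_norm, inv_mul_cancel₀ (hpos k).ne']
  obtain ⟨⟨w, ζ⟩, -, ψ, hψ, hlim⟩ :=
    ((isCompact_closedBall (0 : E) 1).prod (isCompact_closedBall (0 : E) R)).tendsto_subseq
      (x := fun k => (‖z k - zb‖⁻¹ • (z k - zb), q k)) fun k =>
        ⟨by simp [(hunit k).le], by simpa using hR k⟩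
  rw [nhds_prod_eq] at hlim
  have hw := hlim.fst
  have hζ := hlim.snd
  -- With these distances as step sizes, the same sequences witness both the tangency of `w` and the
  -- normality of `ζ` in direction `w`.
  have ht : Tendsto (fun k => ‖z (ψ k) - zb‖) atTop (𝓝 0) :=
    (tendsto_iff_norm_sub_tendsto_zero.1 hz).comp hψ.tendsto_atTop
  have heq : ∀ k, zb + ‖z (ψ k) - zb‖ • (‖z (ψ k) - zb‖⁻¹ • (z (ψ k) - zb)) = z (ψ k) := fun k => by
    rw [smul_inv_smul₀ (hpos _).ne', add_sub_cancel]
  refine ⟨w, ζ, ψ, hψ, ⟨hzb, _, _, fun k => hpos (ψ k), ht, hw, fun k => ?_⟩,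
    ⟨hzb, _, _, _, fun k => hpos (ψ k), ht, hw, hζ, fun k => ?_⟩, ?_, hw, hζ⟩
  · simp only [Function.comp_apply, heq]
    exact (hq _).1
  · simp only [Function.comp_apply, heq]
    exact hq _
  · exact tendsto_nhds_unique hw.norm (by simp [hunit])

end Cones

section SetValued

variable {m n : ℕ}

/-- Its contrapositive supplies the bad points. Only `x'` is localized, since the definition lets
`ys` roam freely; closeness of `y'` follows later from the failed estimate. -/
theorem isCalmAt_of_exists_bound {M : EuclideanSpace ℝ (Fin m) → Set (EuclideanSpace ℝ (Fin n))}
    {y : EuclideanSpace ℝ (Fin m)} {x : EuclideanSpace ℝ (Fin n)} (hx : x ∈ M y)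
    {κ δ : ℝ} (hκ : 0 < κ) (hδ : 0 < δ)
    (h : ∀ y' x', x' ∈ M y' → ‖x' - x‖ < δ → ∃ xt ∈ M y, ‖x' - xt‖ ≤ κ * ‖y' - y‖) :
    IsCalmAt M y x := by
  classical
  refine ⟨κ, hκ, fun xs ys hxs hM => ?_⟩
  have hex : ∀ k, ∃ xt ∈ M y, ‖xs k - x‖ < δ → ‖xs k - xt‖ ≤ κ * ‖ys k - y‖ := fun k => by
    by_cases hk : ‖xs k - x‖ < δ
    · obtain ⟨xt, h1, h2⟩ := h _ _ (hM k) hk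
      exact ⟨xt, h1, fun _ => h2⟩
    -- The default `x` keeps the sequence in `M y` at the indices where no estimate is needed.
    · exact ⟨x, hx, fun hk' => absurd hk' hk⟩
  choose xt h1 h2 using hex
  refine ⟨xt, h1, ?_⟩
  filter_upwards [hxs (Metric.ball_mem_nhds x hδ)] with k hk
  exact h2 k (mem_ball_iff_norm.1 hk)

end SetValued

end VarAnalysis

open VarAnalysis in
theorem mainTheorem4 (m n : ℕ)
    (M : EuclideanSpace ℝ (Fin m) → Set (EuclideanSpace ℝ (Fin n)))
    (ybar : EuclideanSpace ℝ (Fin m)) (xbar : EuclideanSpace ℝ (Fin n))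
    (hmem : WithLp.toLp 2 (ybar, xbar) ∈ VarAnalysis.gph M)
    (hclosed : VarAnalysis.LocallyClosedAround (VarAnalysis.gph M) (WithLp.toLp 2 (ybar, xbar)))
    (hFOSC : VarAnalysis.FOSCclm M ybar xbar) :
    VarAnalysis.IsCalmAt M ybar xbar := by
  by_contra hcalm
  set zb : WithLp 2 (EuclideanSpace ℝ (Fin m) × EuclideanSpace ℝ (Fin n)) :=
    WithLp.toLp 2 (ybar, xbar) with hzb
  obtain ⟨U, hU, -, hclU⟩ := hclosed
  obtain ⟨r, hr, hrU⟩ := Metric.nhds_basis_closedBall.mem_iff.1 hU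
  have hseq : ∀ k : ℕ, ∃ z q : WithLp 2 (EuclideanSpace ℝ (Fin m) × EuclideanSpace ℝ (Fin n)),
      ‖z - zb‖ < 1 / ((k : ℝ) + 1) ∧ z ≠ zb ∧
      ((k : ℝ) + 2) * ‖z.fst - zb.fst‖ ≤ ‖z.snd - zb.snd‖ ∧
      q ∈ regularNormalCone (gph M) z ∧ ‖q.fst‖ = 1 ∧ ((k : ℝ) + 2) * ‖q.snd‖ ≤ 2 := by
    intro k
    -- The first bound keeps the graph closed in the ball, the second forces `z` to converge to
    -- `zb`.
    set ρ : ℝ := min r (1 / ((k : ℝ) + 1))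
    have hρ : 0 < ρ := lt_min hr (by positivity)
    have hcl : IsClosed (gph M ∩ Metric.closedBall zb ρ) := by
      have h1 : Metric.closedBall zb ρ ⊆ U :=
        (Metric.closedBall_subset_closedBall (min_le_left _ _)).trans hrU
      rw [← Set.inter_eq_right.2 h1, ← Set.inter_assoc]
      exact hclU.inter Metric.isClosed_closedBall
    have hbad := mt (isCalmAt_of_exists_bound (M := M) hmem
      (κ := ((k : ℝ) + 2) ^ 2) (δ := ρ / 3) (by positivity) (by positivity)) hcalm
    push Not at hbad
    obtain ⟨y, x, hxy, hx, hfar⟩ := hbad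
    obtain ⟨z, hz, hne, hdir, q, hq, hq1, hq2⟩ := exists_regularNormal_of_penalty
      (Ω := gph M) (zb := zb) (p := WithLp.toLp 2 (y, x)) (r := ρ) (k := (k : ℝ) + 2)
      (by linarith [k.cast_nonneg (α := ℝ)]) hcl hmem hxy
      (by rw [WithLp.toLp_snd]; linarith) fun x' hx' => hfar x' hx'
    exact ⟨z, q, (mem_ball_iff_norm.1 hz).trans_le (min_le_right _ _), hne, hdir, hq, hq1, hq2⟩
  choose z q hz hne hdir hq hq1 hq2 using hseq
  have hk2 : ∀ k : ℕ, 2 ≤ (k : ℝ) + 2 := fun k => by linarith [k.cast_nonneg (α := ℝ)]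
  have hlim0 : Tendsto (fun k : ℕ => 2 / ((k : ℝ) + 2)) atTop (𝓝 0) :=
    tendsto_const_nhds.div_atTop (tendsto_atTop_add_const_right _ _ tendsto_natCast_atTop_atTop)
  have hzlim : Tendsto z atTop (𝓝 zb) :=
    tendsto_iff_norm_sub_tendsto_zero.2 <| squeeze_zero (fun _ => norm_nonneg _)
      (fun k => (hz k).le) tendsto_one_div_add_atTop_nhds_zero_nat
  have hqsnd : ∀ k, ‖(q k).snd‖ ≤ 2 / ((k : ℝ) + 2) := fun k => by
    rw [le_div_iff₀ (by linarith [hk2 k]), mul_comm]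
    exact hq2 k
  have hqb : ∀ k, ‖q k‖ ≤ 2 := fun k => by
    refine abs_le_of_sq_le_sq' ?_ zero_le_two |>.2
    rw [WithLp.prod_norm_sq_eq_of_L2, hq1]
    have : ‖(q k).snd‖ ≤ 1 := by nlinarith [hq2 k, hk2 k, norm_nonneg (q k).snd]
    nlinarith [norm_nonneg (q k).snd]
  obtain ⟨w, ζ, ψ, hψ, hwT, hζN, hw1, hw, hζ⟩ :=
    exists_directionalLimitingNormal hmem hzlim hne hq hqb
  have cfst := (WithLp.fstL 2 ℝ (EuclideanSpace ℝ (Fin m)) (EuclideanSpace ℝ (Fin n))).continuous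
  have csnd := (WithLp.sndL 2 ℝ (EuclideanSpace ℝ (Fin m)) (EuclideanSpace ℝ (Fin n))).continuous
  have hwfst : w.fst = 0 := by
    have h1 := (cfst.tendsto w).comp hw
    refine tendsto_nhds_unique h1 (squeeze_zero_norm (fun k => ?_)
      (hlim0.comp hψ.tendsto_atTop))
    -- Dividing `hdir` by `‖z (ψ k) - zb‖` bounds the first component by `1 / (ψ k + 2)`; the weaker
    -- `2 / (ψ k + 2)` lets `hlim0` serve again.
    have hpos : 0 < ‖z (ψ k) - zb‖ := norm_pos_iff.2 (sub_ne_zero.2 (hne _))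
    have h2 := hdir (ψ k)
    have h3 := WithLp.norm_snd_le _ (z (ψ k) - zb)
    have h4 := hk2 (ψ k)
    simp only [Function.comp_apply, WithLp.fstL_apply, WithLp.smul_fst, WithLp.sub_fst, norm_smul,
      norm_inv, norm_norm]
    rw [WithLp.sub_snd] at h3
    rw [inv_mul_le_iff₀ hpos, mul_div_assoc', le_div_iff₀ (by linarith)]
    linarith
  have hζsnd : ζ.snd = 0 :=
    tendsto_nhds_unique ((csnd.tendsto ζ).comp hζ) (squeeze_zero_norm (fun k => hqsnd (ψ k))
      (hlim0.comp hψ.tendsto_atTop))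
  have hζfst : ‖ζ.fst‖ = 1 := by
    refine tendsto_nhds_unique ((cfst.tendsto ζ).comp hζ).norm ?_
    simp [Function.comp_def, hq1]
  have hweq : w = WithLp.toLp 2 (0, w.snd) := by rw [← hwfst]; rfl
  have hζeq : ζ = WithLp.toLp 2 (ζ.fst, -0) := by rw [neg_zero, ← hζsnd]; rfl
  have hwsnd : w.snd ≠ 0 := fun h => by
    have := WithLp.prod_norm_sq_eq_of_L2 w
    simp [hwfst, h, hw1] at this
  have hco : ζ.fst ∈ directionalLimitingCoderivative M ybar xbar 0 w.snd 0 := by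
    change WithLp.toLp 2 (ζ.fst, -0) ∈ directionalLimitingNormalCone (gph M) zb
      (WithLp.toLp 2 (0, w.snd))
    rwa [← hweq, ← hζeq]
  rw [hFOSC w.snd ⟨by change WithLp.toLp 2 (0, w.snd) ∈ bouligandCone (gph M) zb; rwa [← hweq],
    hwsnd⟩] at hco
  simp [Set.mem_singleton_iff.1 hco] at hζfst
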